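/- **Setting.** All manifolds are real, finite-dimensional, Hausdorff, second countable, of class $C^1$ and without boundary. A *flow of piecewise diffeomorphisms* $b^t$ on a manifold $\Psi$ consists of an open set $D\subset\mathbb R\times\Psi$ of *regular pairs* and of a $C^1$ map $(t,x)\mapsto b^t x$ on $D$, where $b^0=\mathrm{id}$; if $(s,x)\in D$ and $(t,b^sx)\in D$, then $(t+s,x)\in D$ and $b^{t+s}x=b^tb^sx$; if $(t,x)\in D$, then $(-t,b^tx)\in D$; and for each $t$ the set $\{x:(t,x)\notin D\}$ is Lebesgue-null. (So each $b^t$ is a diffeomorphism between open sets of full measure.) Let $V(x)=\frac{d}{dt}\big|_{t=0}b^tx$ be its velocity at $x$, for $(0,x)\in D$. Let the following data be given. 1. A fibration $q:\Psi\to Z$ (a surjective $C^1$ submersion onto a manifold $Z$, which need not be compact) whose fibers $R_z=q^{-1}(z)$ are transversal to the flow: $dq_x(V(x))\neq0$ whenever $(0,x)\in D$. 2. An embedded submanifold $M\subset\Psi$ (which need not be a closed subset) with $\dim M=\dim Z-1$, transversal to the flow: $(0,m)\in D$ and $V(m)\notin T_mM$ for all $m\in M$. Put $$W=\{(m,t)\in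 M\times\mathbb R_+ : (-t,m)\in D\},\qquad \mathbb R_+=[0,\infty),$$ and let $N=\{b^{-t}m:(m,t)\in W\}$. For $(m,t)\in W$ and $x=b^{-t}m$, say that $N$ is transversal to the fiber at $(m,t)$ if $T+T_xR_{q(x)}=T_x\Psi$, where $T=d(b^{-t}|_M)(T_mM)+\mathbb R V(x)$. Assume that, for almost every $z\in Z$ (in particular, if for every $z\in Z$), $N$ is transversal to the fiber $R_z$, i.e. at every $(m,t)\in W$ with $b^{-t}m\in R_z$. Let $dz$, $dm$ be finite measures of Lebesgue class on $Z$, $M$ (their null sets are exactly the sets that are Lebesgue-null in charts), and let $dt$ be the Lebesgue measure. For a Borel weight $w:\Psi\times\mathbb R_+\to[0,\infty]$ define the weighted counting function $$g(z;w)=\sum_{(x,t)\in G(z)}w(x,t),\qquad G(z)=\{(x,t): x\in R_z,\ t\ge0,\ (t,x)\in D,\ b^tx\in M\}.$$ **Proposition.** There is a Borel function $r\ge0$ on $M\times\mathbb R_+$, independent of $w$, such that: (a) $r(m,t)>0$ if and only if $(m,t)\in W$ and $N$ is transversal to the fiber at $(m,t)$; in particular $r>0$ on all of $W$ if $N$ is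 transversal to all fibers; (b) $r(m,t)\,dm\,dt$ is the pullback of $dz$ under $f:W\to Z$, $f(m,t)=q(b^{-t}m)$: for every Borel set $A\subset W$ on which $f$ is injective, $\int_A r\,dm\,dt$ equals the $dz$-measure of $f(A)$; (c) for every Borel weight $w:\Psi\times\mathbb R_+\to[0,\infty]$ (for instance a continuous non-negative function, or the indicator function of $0\le t\le l$), $g(\cdot\,;w)$ is measurable up to a $dz$-null set, and, as an equality in $[0,\infty]$, $$\int_Z g(z;w)\,dz=\int_{M\times\mathbb R_+}w(b^{-t}m,t)\,r(m,t)\,dm\,dt,$$ where the integrand on the right is $0$ outside $W$. -/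

import Mathlib

open Set MeasureTheory Manifold
open scoped Manifold ContDiff NNReal ENNReal

noncomputable section

/-- A subset of an `n`-dimensional manifold is Lebesgue-null if it is null in all charts. -/
def IsLebesgueNull (n : ℕ) {X : Type*} [TopologicalSpace X]
    [ChartedSpace (EuclideanSpace ℝ (Fin n)) X] (A : Set X) : Prop :=
  ∀ e ∈ atlas (EuclideanSpace ℝ (Fin n)) X, volume (e '' (A ∩ e.source)) = 0

/-- A measure on an `n`-dimensional manifold is of Lebesgue class if its null sets are exactly the
sets that are Lebesgue-null in charts. -/
def IsLebesgueClass (n : ℕ) {X : Type*} [TopologicalSpace X]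
    [ChartedSpace (EuclideanSpace ℝ (Fin n)) X] [MeasurableSpace X] (μ : Measure X) : Prop :=
  ∀ A : Set X, μ A = 0 ↔ IsLebesgueNull n A

/-- A flow `b^t` of piecewise `C^1` diffeomorphisms of an `n`-manifold `Ψ`.

`dom` is the set of the regular pairs `(t, x)`: those at which `b^t x` is defined (and `C^1` jointly
in time and space). The values `b^t x` at singular pairs `(t, x) ∉ dom` carry no meaning. For each
time `t`, the map `b^t` is a `C^1` diffeomorphism of the open set `{x | (t, x) ∈ dom}` onto the open
set `{x | (-t, x) ∈ dom}`, and both have Lebesgue-null complements. -/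
structure PiecewiseFlow (n : ℕ) (Ψ : Type*) [TopologicalSpace Ψ]
    [ChartedSpace (EuclideanSpace ℝ (Fin n)) Ψ] where
  /-- the regular pairs `(t, x)` -/
  dom : Set (ℝ × Ψ)
  /-- `map t x` is `b^t x` -/
  map : ℝ → Ψ → Ψ
  isOpen_dom : IsOpen dom
  contMDiffOn : ContMDiffOn (𝓘(ℝ, ℝ).prod (𝓡 n)) (𝓡 n) 1 (fun p : ℝ × Ψ => map p.1 p.2) dom
  isLebesgueNull_singular : ∀ t : ℝ, IsLebesgueNull n {x : Ψ | (t, x) ∉ dom}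
  map_zero : ∀ x : Ψ, map 0 x = x
  neg_mem : ∀ {t : ℝ} {x : Ψ}, (t, x) ∈ dom → (-t, map t x) ∈ dom
  add_mem : ∀ {s t : ℝ} {x : Ψ}, (s, x) ∈ dom → (t, map s x) ∈ dom → (t + s, x) ∈ dom
  map_add : ∀ {s t : ℝ} {x : Ψ}, (s, x) ∈ dom → (t, map s x) ∈ dom →
    map (t + s) x = map t (map s x)

namespace PiecewiseFlow

variable {n : ℕ} {Ψ Z M : Type*}
  [TopologicalSpace Ψ] [ChartedSpace (EuclideanSpace ℝ (Fin n)) Ψ]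

/-- The velocity `d/dt b^t x` at `t = 0` of the flow at the point `x`
(here `T_{b^0 x} Ψ = T_x Ψ`, since `b^0 x = x`). -/
def velocity (Φ : PiecewiseFlow n Ψ) (x : Ψ) : TangentSpace (𝓡 n) x :=
  mfderiv 𝓘(ℝ, ℝ) (𝓡 n) (fun t : ℝ => Φ.map t x) 0 (1 : ℝ)

/-- The fibers of `q` are transversal to the flow: the velocity is never tangent to the fiber. -/
def FibersTransversal (d : ℕ) {Z : Type*} [TopologicalSpace Z]
    [ChartedSpace (EuclideanSpace ℝ (Fin (d + 1))) Z] (Φ : PiecewiseFlow n Ψ) (q : Ψ → Z) : Prop :=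
  ∀ x : Ψ, (0, x) ∈ Φ.dom → mfderiv (𝓡 n) (𝓡 (d + 1)) q x (Φ.velocity x) ≠ 0

/-- The submanifold `ι : M → Ψ` is transversal to the flow: around its points the flow is regular
for small times, and the velocity is not tangent to the submanifold. -/
def SubmanifoldTransversal (d : ℕ) {M : Type*} [TopologicalSpace M]
    [ChartedSpace (EuclideanSpace ℝ (Fin d)) M] (Φ : PiecewiseFlow n Ψ) (ι : M → Ψ) : Prop :=
  ∀ m : M, (0, ι m) ∈ Φ.dom ∧ Φ.velocity (ι m) ∉ Set.range (mfderiv (𝓡 d) (𝓡 n) ι m)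

/-- The tangent space at `x = b^s m` to the union of the images `b^s M`, along the branch through
`(s, m)`: it is spanned by the tangent space to `b^s M` and by the velocity of the flow. -/
def sweepTangent (d : ℕ) {M : Type*} [TopologicalSpace M]
    [ChartedSpace (EuclideanSpace ℝ (Fin d)) M] (Φ : PiecewiseFlow n Ψ) (ι : M → Ψ) (s : ℝ) (m : M) :
    Submodule ℝ (TangentSpace (𝓡 n) (Φ.map s (ι m))) :=
  LinearMap.range (mfderiv (𝓡 d) (𝓡 n) (fun m' : M => Φ.map s (ι m')) m).toLinearMap ⊔
    Submodule.span ℝ {Φ.velocity (Φ.map s (ι m))}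

/-- At the point `b^s m`, the union `N` of the images `b^s M` (more precisely, its branch through
`(s, m)`) is transversal to the fiber of `q`: the two tangent spaces span that of `Ψ`. -/
def SweepTransversalAt (d : ℕ) {Z M : Type*}
    [TopologicalSpace Z] [ChartedSpace (EuclideanSpace ℝ (Fin (d + 1))) Z]
    [TopologicalSpace M] [ChartedSpace (EuclideanSpace ℝ (Fin d)) M]
    (Φ : PiecewiseFlow n Ψ) (q : Ψ → Z) (ι : M → Ψ) (s : ℝ) (m : M) : Prop :=
  Φ.sweepTangent d ι s m ⊔
    LinearMap.ker (mfderiv (𝓡 n) (𝓡 (d + 1)) q (Φ.map s (ι m))).toLinearMap = ⊤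

/-- The pairs `(m, t)` with `t ≥ 0` for which `b^{-t} m` is defined. -/
def backwardDomain (Φ : PiecewiseFlow n Ψ) (ι : M → Ψ) : Set (M × ℝ) :=
  {p | 0 ≤ p.2 ∧ (-p.2, ι p.1) ∈ Φ.dom}

/-- The union `N` of the images `b^{-t} M`, `t ≥ 0`, is transversal to the fiber over `z`. -/
def SweepTransversalToFiber (d : ℕ) {Z M : Type*}
    [TopologicalSpace Z] [ChartedSpace (EuclideanSpace ℝ (Fin (d + 1))) Z]
    [TopologicalSpace M] [ChartedSpace (EuclideanSpace ℝ (Fin d)) M]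
    (Φ : PiecewiseFlow n Ψ) (q : Ψ → Z) (ι : M → Ψ) (z : Z) : Prop :=
  ∀ p ∈ Φ.backwardDomain ι, q (Φ.map (-p.2) (ι p.1)) = z → Φ.SweepTransversalAt d q ι (-p.2) p.1

/-- The visits to `M` of the orbits that start in the fiber over `z`: the pairs `(x, t)` with
`q x = z`, `t ≥ 0` and `b^t x ∈ M`. -/
def visits (Φ : PiecewiseFlow n Ψ) (q : Ψ → Z) (ι : M → Ψ) (z : Z) : Set (Ψ × ℝ) :=
  {p | q p.1 = z ∧ 0 ≤ p.2 ∧ (p.2, p.1) ∈ Φ.dom ∧ Φ.map p.2 p.1 ∈ Set.range ι}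

/-- The weighted counting function `g(z; w)`, the sum of `w(x, t)` over the visits `(x, t)`. -/
def countingFunction (Φ : PiecewiseFlow n Ψ) (q : Ψ → Z) (ι : M → Ψ) (w : Ψ × ℝ → ℝ≥0∞)
    (z : Z) : ℝ≥0∞ :=
  ∑' p : Φ.visits q ι z, w p

end PiecewiseFlow

end

/-! The map `f (m, t) = q (b^{-t} m)` goes between manifolds of the same dimension `d + 1`. By the
group law its differential has image `dq T`, with `T` the tangent space of the branch of `N`; as
`dq` is onto with kernel the tangent space of the fiber, the differential is invertible exactly
where `N` is transversal to the fiber (`isInvertible_mfderiv_iff`). By the inverse function theorem,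
countably many open sets cover the regular points, and on each `f` is injective and preserves Borel
sets and null sets both ways (`ContMDiffOn.exists_isOpen_injOn`). Radon-Nikodym on disjoint pieces
gives a density `r`, and summing over the pieces gives `∫ ∑_{f p = z} h p dz = ∫ h r dm dt`, the sum
being over regular `p` with `t ≥ 0` (`ContMDiffOn.exists_density`). Critical points need no Sard
theorem: by assumption almost every `z` has no critical preimage in `W`. Finally `(m, t) ↦ (b^{-t}
m, t)` identifies the fiber of `f` in `W` with the visits (`visitsEquiv`), so the sum with `h p = w
(b^{-t} m, t)` is `g(z; w)` for almost every `z`. -/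

/-! ### Measure theory: pullback densities and sums over fibers -/

/-- The density, with respect to `μ`, of the pullback of `ν` under a map `f` which is injective on
the measurable set `A` and there preserves measurable sets and null sets in both directions. -/
theorem exists_density_of_injOn {X Z : Type*} [MeasurableSpace X] [MeasurableSpace Z] (f : X → Z)
    (μ : Measure X) [SigmaFinite μ] (ν : Measure Z) [IsFiniteMeasure ν] {A : Set X}
    (hA : MeasurableSet A) (hinj : InjOn f A)
    (hpre : ∀ C : Set Z, MeasurableSet C → MeasurableSet (A ∩ f ⁻¹' C))
    (himg : ∀ B ⊆ A, MeasurableSet B → MeasurableSet (f '' B))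
    (hnull : ∀ B ⊆ A, MeasurableSet B → (ν (f '' B) = 0 ↔ μ B = 0)) :
    ∃ r : X → ℝ≥0∞, Measurable r ∧ (∀ p ∈ A, r p ≠ 0 ∧ r p ≠ ⊤) ∧ (∀ p ∉ A, r p = 0) ∧
      ∀ h : X → ℝ≥0∞, Measurable h →
        Measurable (fun z => ∑' p : {p // p ∈ A ∧ f p = z}, h p) ∧
        ∫⁻ z, ∑' p : {p // p ∈ A ∧ f p = z}, h p ∂ν = ∫⁻ p, r p * h p ∂μ := by
  classical
  set F : A → Z := fun a => f a with hF
  have hFm : MeasurableEmbedding F :=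
    { injective := fun a b hab => Subtype.ext (hinj a.2 b.2 hab)
      measurable := by
        intro C hC
        convert! measurable_subtype_coe (hpre C hC) using 1
        ext a
        simp [hF]
      measurableSet_image' := by
        intro s hs
        have := himg (Subtype.val '' s) (by simp) (hA.subtype_image hs)
        rwa [image_image] at this }
  set κ : Measure X := (ν.comap F).map Subtype.val with hκ
  have hκapp : ∀ B : Set X, MeasurableSet B → κ B = ν (f '' (B ∩ A)) := by
    intro B hB
    rw [hκ, Measure.map_apply measurable_subtype_coe hB, hFm.comap_apply]
    congr 1
    ext z
    simp [hF, and_assoc, and_left_comm]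
  have : IsFiniteMeasure κ := ⟨by
    rw [hκapp _ MeasurableSet.univ]; exact measure_lt_top _ _⟩
  have hac : κ ≪ μ := by
    refine Measure.AbsolutelyContinuous.mk fun B hB h0 => ?_
    rw [hκapp _ hB, hnull _ inter_subset_right (hB.inter hA)]
    exact measure_mono_null inter_subset_left h0
  set ρ := κ.rnDeriv μ with hρ
  have hρm : Measurable ρ := Measure.measurable_rnDeriv _ _
  have hρint : ∀ h : X → ℝ≥0∞, Measurable h → ∫⁻ p, h p ∂κ = ∫⁻ p, ρ p * h p ∂μ := by
    intro h hh
    rw [lintegral_rnDeriv_mul hac hh.aemeasurable]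
  -- By injectivity the fiber sum has at most one term: it is `h` carried along `F` and extended by
  -- zero.
  have hsum : ∀ h : X → ℝ≥0∞, (fun z => ∑' p : {p // p ∈ A ∧ f p = z}, h p)
      = Function.extend F (fun a : A => h a) 0 := by
    intro h
    ext z
    by_cases hz : ∃ a : A, F a = z
    · obtain ⟨a, rfl⟩ := hz
      rw [hFm.injective.extend_apply]
      rw [tsum_eq_single (⟨a, a.2, rfl⟩ : {p // p ∈ A ∧ f p = F a})]
      intro b hb
      exact absurd (Subtype.ext (hinj b.2.1 a.2 b.2.2)) hb
    · rw [Function.extend_apply' _ _ _ hz]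
      have : IsEmpty {p // p ∈ A ∧ f p = z} := ⟨fun p => hz ⟨⟨p, p.2.1⟩, p.2.2⟩⟩
      simp
  -- The Radon-Nikodym derivative is determined only almost everywhere, while positivity is claimed
  -- at every point of `A`. The values `0` and `⊤` on `A` are replaced by `1`; they occur there only
  -- on a `μ`-null set, by `hnull` and by finiteness of `κ`.
  refine ⟨A.indicator fun p => if ρ p = 0 ∨ ρ p = ⊤ then 1 else ρ p, ?_, ?_, ?_, ?_⟩
  · refine Measurable.indicator (Measurable.ite ?_ measurable_const hρm) hA
    exact (hρm (measurableSet_singleton 0)).union (hρm (measurableSet_singleton ⊤))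
  · intro p hp
    rw [indicator_of_mem hp]
    split_ifs with h
    · simp
    · push Not at h; exact h
  · intro p hp
    rw [indicator_of_notMem hp]
  · intro h hh
    rw [hsum]
    have hme : Measurable (Function.extend F (fun a : A => h a) 0) :=
      hFm.measurable_extend (hh.comp measurable_subtype_coe) measurable_const
    refine ⟨hme, ?_⟩
    have h1 : ∫⁻ z, Function.extend F (fun a : A => h a) 0 z ∂ν = ∫⁻ p, h p ∂κ := by
      rw [hκ, lintegral_map hh measurable_subtype_coe]
      have : ∫⁻ z, Function.extend F (fun a : A => h a) 0 z ∂ν =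
          ∫⁻ z in range F, Function.extend F (fun a : A => h a) 0 z ∂ν := by
        rw [← lintegral_indicator hFm.measurableSet_range]
        congr 1
        ext z
        by_cases hz : z ∈ range F
        · rw [indicator_of_mem hz]
        · rw [indicator_of_notMem hz, Function.extend_apply' _ _ _ hz]; rfl
      rw [this, ← hFm.map_comap, hFm.lintegral_map]
      simp [hFm.injective.extend_apply]
    rw [h1, hρint h hh]
    refine lintegral_congr_ae ?_
    have hfin : ∀ᵐ p ∂μ, ρ p ≠ ⊤ := Measure.rnDeriv_ne_top _ _
    have hpos : ∀ᵐ p ∂μ, p ∈ A → ρ p ≠ 0 := by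
      have hB : MeasurableSet (A ∩ ρ ⁻¹' {0}) := hA.inter (hρm (measurableSet_singleton 0))
      have : κ (A ∩ ρ ⁻¹' {0}) = 0 := by
        rw [← Measure.setLIntegral_rnDeriv hac, setLIntegral_eq_zero_iff hB hρm]
        exact ae_of_all _ fun p hp => hp.2
      rw [hκapp _ hB, inter_eq_left.2 inter_subset_left, hnull _ inter_subset_left hB] at this
      filter_upwards [measure_eq_zero_iff_ae_notMem.1 this] with p hp hpA h0
      exact hp ⟨hpA, h0⟩
    have hzero : ∀ᵐ p ∂μ, p ∉ A → ρ p = 0 := by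
      have : κ Aᶜ = 0 := by rw [hκapp _ hA.compl]; simp
      rw [← Measure.setLIntegral_rnDeriv hac, setLIntegral_eq_zero_iff hA.compl hρm] at this
      exact this
    filter_upwards [hfin, hpos, hzero] with p h1 h2 h3
    by_cases hp : p ∈ A
    · rw [indicator_of_mem hp, if_neg (by simp [h1, h2 hp])]
    · rw [indicator_of_notMem hp, h3 hp]

/-- The density of the pullback of `ν` under a map `f`, on the disjoint union of countably many sets
on each of which `f` is injective and preserves measurable sets and null sets in both directions. -/
theorem exists_density_of_injOn_iUnion {X Z : Type*} [MeasurableSpace X] [MeasurableSpace Z]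
    (f : X → Z) (μ : Measure X) [SigmaFinite μ] (ν : Measure Z) [IsFiniteMeasure ν] {A : ℕ → Set X}
    (hdisj : Pairwise (Function.onFun Disjoint A))
    (hA : ∀ i, MeasurableSet (A i)) (hinj : ∀ i, InjOn f (A i))
    (hpre : ∀ i, ∀ C : Set Z, MeasurableSet C → MeasurableSet (A i ∩ f ⁻¹' C))
    (himg : ∀ i, ∀ B ⊆ A i, MeasurableSet B → MeasurableSet (f '' B))
    (hnull : ∀ i, ∀ B ⊆ A i, MeasurableSet B → (ν (f '' B) = 0 ↔ μ B = 0)) :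
    ∃ r : X → ℝ≥0, Measurable r ∧ (∀ p, 0 < r p ↔ p ∈ ⋃ i, A i) ∧
      ∀ h : X → ℝ≥0∞, Measurable h →
        Measurable (fun z => ∑' p : {p // p ∈ ⋃ i, A i ∧ f p = z}, h p) ∧
        ∫⁻ z, ∑' p : {p // p ∈ ⋃ i, A i ∧ f p = z}, h p ∂ν = ∫⁻ p, h p * r p ∂μ := by
  classical
  choose r hrm hrpos hrzero hr using fun i =>
    exists_density_of_injOn f μ ν (hA i) (hinj i) (hpre i) (himg i) (hnull i)
  have hval : ∀ i, ∀ p ∈ A i, ∑' j, r j p = r i p := by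
    intro i p hp
    refine tsum_eq_single i fun j hj => hrzero j p fun hpj => ?_
    exact disjoint_left.1 (hdisj hj) hpj hp
  have hval0 : ∀ p, p ∉ ⋃ i, A i → ∑' j, r j p = 0 := by
    intro p hp
    rw [ENNReal.tsum_eq_zero]
    exact fun i => hrzero i p fun h => hp (mem_iUnion_of_mem i h)
  -- At most one summand is nonzero, and it is finite, so passing to `ℝ≥0` loses nothing.
  have hcoe : ∀ p, (((∑' j, r j p).toNNReal : ℝ≥0) : ℝ≥0∞) = ∑' j, r j p := by
    intro p
    refine ENNReal.coe_toNNReal ?_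
    by_cases hp : p ∈ ⋃ i, A i
    · obtain ⟨i, hi⟩ := mem_iUnion.1 hp
      rw [hval i p hi]; exact (hrpos i p hi).2
    · simp [hval0 p hp]
  refine ⟨fun p => (∑' j, r j p).toNNReal, (Measurable.tsum hrm).ennreal_toNNReal, ?_, ?_⟩
  · intro p
    rw [← ENNReal.coe_pos, hcoe]
    constructor
    · intro h
      by_contra hp
      rw [hval0 p hp] at h
      exact lt_irrefl _ h
    · intro hp
      obtain ⟨i, hi⟩ := mem_iUnion.1 hp
      rw [hval i p hi]; exact pos_iff_ne_zero.2 (hrpos i p hi).1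
  · intro h hh
    have hsum : (fun z => ∑' p : {p // p ∈ ⋃ i, A i ∧ f p = z}, h p)
        = fun z => ∑' i, ∑' p : {p // p ∈ A i ∧ f p = z}, h p := by
      ext z
      have h1 : ∀ S : Set X, ∑' p : {p // p ∈ S ∧ f p = z}, h p =
          ∑' p, {p | p ∈ S ∧ f p = z}.indicator h p := fun S =>
        tsum_subtype {p | p ∈ S ∧ f p = z} h
      simp only [h1]
      rw [ENNReal.tsum_comm]
      congr 1
      ext p
      by_cases hp : p ∈ ⋃ i, A i
      · obtain ⟨i, hi⟩ := mem_iUnion.1 hp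
        rw [tsum_eq_single i]
        · rw [indicator_apply, indicator_apply]; exact if_congr (by simp only [mem_ofPred_eq, hp, hi]) rfl rfl
        · intro j hj
          refine indicator_of_notMem (fun hpj => ?_) _
          exact disjoint_left.1 (hdisj hj) hpj.1 hi
      · rw [indicator_of_notMem (fun h => hp h.1), eq_comm, ENNReal.tsum_eq_zero]
        exact fun i => indicator_of_notMem (fun h => hp (mem_iUnion_of_mem i h.1)) _
    constructor
    · rw [hsum]
      exact Measurable.tsum fun i => (hr i h hh).1
    · rw [hsum, lintegral_tsum fun i => (hr i h hh).1.aemeasurable]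
      simp only [hcoe, ← ENNReal.tsum_mul_left]
      have hm : ∀ i, AEMeasurable (fun p => h p * r i p) μ := fun i => (hh.mul (hrm i)).aemeasurable
      rw [lintegral_tsum hm]
      congr 1
      ext i
      rw [(hr i h hh).2]
      simp only [mul_comm]

/-! ### Null sets in charts and in products -/

/-- `L.symm ∘ f` is a differentiable map of `E` to itself, hence preserves null sets, and the two
Haar measures `ν` and `μ.map L` have the same null sets. -/
theorem addHaar_image_eq_zero_of_differentiableOn {E F : Type*} [NormedAddCommGroup E]
    [NormedSpace ℝ E] [FiniteDimensional ℝ E] [MeasurableSpace E] [BorelSpace E]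
    [NormedAddCommGroup F] [NormedSpace ℝ F] [MeasurableSpace F] [BorelSpace F]
    (μ : Measure E) [μ.IsAddHaarMeasure] (ν : Measure F) [ν.IsAddHaarMeasure] (L : E ≃L[ℝ] F)
    {f : E → F} {s : Set E} (hf : DifferentiableOn ℝ f s) (hs : μ s = 0) : ν (f '' s) = 0 := by
  have : FiniteDimensional ℝ F := L.toLinearEquiv.finiteDimensional
  have : ProperSpace F := FiniteDimensional.proper ℝ F
  have := L.isAddHaarMeasure_map μ
  refine Measure.absolutelyContinuous_isAddHaarMeasure ν (μ.map L) ?_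
  have h : μ ((L.symm ∘ f) '' s) = 0 :=
    addHaar_image_eq_zero_of_differentiableOn_of_addHaar_eq_zero μ
      (L.symm.differentiable.comp_differentiableOn hf) hs
  rw [show (L : E → F) = L.toHomeomorph.toMeasurableEquiv from rfl, MeasurableEquiv.map_apply]
  rwa [image_comp, L.symm.image_eq_preimage_symm] at h

/-- Transition maps are differentiable and so preserve null sets; hence one chart containing the set
decides. -/
theorem isLebesgueNull_iff_of_mem_atlas {n : ℕ} {X : Type*} [TopologicalSpace X]
    [ChartedSpace (EuclideanSpace ℝ (Fin n)) X] [IsManifold (𝓡 n) 1 X]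
    {e : OpenPartialHomeomorph X (EuclideanSpace ℝ (Fin n))}
    (he : e ∈ atlas (EuclideanSpace ℝ (Fin n)) X) {A : Set X} (hA : A ⊆ e.source) :
    IsLebesgueNull n A ↔ volume (e '' A) = 0 := by
  refine ⟨fun h => by simpa [inter_eq_left.2 hA] using h e he, fun h e' he' => ?_⟩
  have hd : DifferentiableOn ℝ (e' ∘ e.symm) (e '' (A ∩ e'.source)) := by
    have h1 := contMDiffOn_of_mem_maximalAtlas
      (IsManifold.subset_maximalAtlas (I := 𝓡 n) (n := 1) he')
    have h2 := contMDiffOn_symm_of_mem_maximalAtlas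
      (IsManifold.subset_maximalAtlas (I := 𝓡 n) (n := 1) he)
    have h3 : ContMDiffOn (𝓡 n) (𝓡 n) 1 (e' ∘ e.symm) (e '' (A ∩ e'.source)) := by
      refine h1.comp (h2.mono ?_) ?_
      · rintro _ ⟨x, hx, rfl⟩
        exact e.map_source (hA hx.1)
      · rintro _ ⟨x, hx, rfl⟩
        rw [mem_preimage, e.left_inv (hA hx.1)]
        exact hx.2
    exact (contMDiffOn_iff_contDiffOn.1 h3).differentiableOn (by simp)
  have := addHaar_image_eq_zero_of_differentiableOn volume volume
    (ContinuousLinearEquiv.refl ℝ (EuclideanSpace ℝ (Fin n))) hd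
    (measure_mono_null (image_mono inter_subset_left) h)
  rwa [image_image, image_congr fun x hx => by
    rw [Function.comp_apply, e.left_inv (hA hx.1)]] at this

theorem ContinuousOn.measurableSet_inter_preimage {X Y : Type*} [TopologicalSpace X]
    [MeasurableSpace X] [BorelSpace X] [TopologicalSpace Y] [MeasurableSpace Y] [BorelSpace Y]
    {f : X → Y} {s : Set X} (hf : ContinuousOn f s) (hs : MeasurableSet s) {t : Set Y}
    (ht : MeasurableSet t) : MeasurableSet (s ∩ f ⁻¹' t) := by
  have := hs.subtype_image ((continuousOn_iff_continuous_domRestrict.1 hf).measurable ht)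
  convert! this using 1
  ext x
  simp [and_comm]

theorem OpenPartialHomeomorph.measurableSet_image {X Y : Type*} [TopologicalSpace X]
    [MeasurableSpace X] [BorelSpace X] [TopologicalSpace Y] [MeasurableSpace Y] [BorelSpace Y]
    (e : OpenPartialHomeomorph X Y) {s : Set X} (hs : MeasurableSet s) (h : s ⊆ e.source) :
    MeasurableSet (e '' s) := by
  rw [e.image_eq_target_inter_inv_preimage h]
  exact e.continuousOn_symm.measurableSet_inter_preimage e.open_target.measurableSet hs

/-- Fubini: a set is null exactly when almost all its slices at fixed `t` are, and each slice is
compared in the single chart `e`. -/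
theorem IsLebesgueClass.prod_null_iff {d : ℕ} {M : Type*} [TopologicalSpace M]
    [SecondCountableTopology M] [ChartedSpace (EuclideanSpace ℝ (Fin d)) M] [IsManifold (𝓡 d) 1 M]
    [MeasurableSpace M] [BorelSpace M] {μ : Measure M} [SFinite μ] (hμ : IsLebesgueClass d μ)
    {e : OpenPartialHomeomorph M (EuclideanSpace ℝ (Fin d))}
    (he : e ∈ atlas (EuclideanSpace ℝ (Fin d)) M) {B : Set (M × ℝ)} (hB : MeasurableSet B)
    (hBe : ∀ p ∈ B, p.1 ∈ e.source) :
    μ.prod (volume : Measure ℝ) B = 0 ↔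
      (volume : Measure (EuclideanSpace ℝ (Fin d))).prod (volume : Measure ℝ)
        ((fun p : M × ℝ => (e p.1, p.2)) '' B) = 0 := by
  have hC : MeasurableSet ((fun p : M × ℝ => (e p.1, p.2)) '' B) :=
    (e.prod (OpenPartialHomeomorph.refl ℝ)).measurableSet_image hB
      fun p hp => ⟨hBe p hp, mem_univ _⟩
  rw [Measure.prod_apply_symm hB, Measure.prod_apply_symm hC,
    lintegral_eq_zero_iff (measurable_measure_prodMk_right hB),
    lintegral_eq_zero_iff (measurable_measure_prodMk_right hC)]
  refine Filter.eventually_congr (Filter.Eventually.of_forall fun t => ?_)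
  simp only [Pi.zero_apply]
  rw [hμ, isLebesgueNull_iff_of_mem_atlas he (A := (fun x => (x, t)) ⁻¹' B) fun x hx => hBe _ hx]
  congr! 2
  ext y
  simp only [mem_image, mem_preimage, Prod.mk.injEq, Prod.exists]
  constructor
  · rintro ⟨x, hx, rfl⟩
    exact ⟨x, t, hx, rfl, rfl⟩
  · rintro ⟨x, s, hx, rfl, rfl⟩
    exact ⟨x, hx, rfl⟩

/-! ### Inverse function theorem -/

/-- Invertibility of the derivative is an open condition, so the source of the local inverse can be
shrunk until it holds throughout; then the inverse is differentiable on the whole target, not only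
at `g a`. -/
theorem ContDiffAt.exists_openPartialHomeomorph {E F : Type*} [NormedAddCommGroup E]
    [NormedSpace ℝ E] [CompleteSpace E] [NormedAddCommGroup F] [NormedSpace ℝ F]
    {g : E → F} {a : E} (hg : ContDiffAt ℝ 1 g a) (hinv : (fderiv ℝ g a).IsInvertible)
    {O : Set E} (hO : O ∈ nhds a) :
    ∃ φ : OpenPartialHomeomorph E F, (φ : E → F) = g ∧ a ∈ φ.source ∧ φ.source ⊆ O ∧
      (∀ y ∈ φ.source, (fderiv ℝ g y).IsInvertible) ∧ DifferentiableOn ℝ φ φ.source ∧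
      DifferentiableOn ℝ φ.symm φ.target := by
  obtain ⟨L, hL⟩ := hinv
  have hd : HasFDerivAt g (L : E →L[ℝ] F) a := by
    rw [hL]; exact (hg.differentiableAt (by simp)).hasFDerivAt
  have hinv : ∀ᶠ y in nhds a, (fderiv ℝ g y).IsInvertible := by
    have hc : ContinuousAt (fderiv ℝ g) a :=
      (hg.fderiv_right (m := 0) (by simp)).continuousAt
    have := L.nhds
    rw [hL] at this
    filter_upwards [hc this] with y hy
    exact hy
  set S := {y | y ∈ O ∧ ContDiffAt ℝ 1 g y ∧ (fderiv ℝ g y).IsInvertible} with hS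
  have hSa : S ∈ nhds a := by
    filter_upwards [hO, hg.eventually (by simp), hinv] with y h1 h2 h3 using ⟨h1, h2, h3⟩
  set φ := (hg.toOpenPartialHomeomorph g hd (by simp)).restr S with hφ
  have hφg : (φ : E → F) = g := rfl
  have hφS : φ.source ⊆ S := fun y hy => interior_subset hy.2
  refine ⟨φ, hφg, ⟨hg.mem_toOpenPartialHomeomorph_source hd (by simp), mem_interior_iff_mem_nhds.2 hSa⟩,
    fun y hy => (hφS hy).1, fun y hy => (hφS hy).2.2, fun y hy => ?_, fun z hz => ?_⟩
  · exact ((hφS hy).2.1.differentiableAt (by simp)).differentiableWithinAt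
  · have hy := hφS (φ.map_target hz)
    obtain ⟨L', hL'⟩ := hy.2.2
    have := φ.contDiffAt_symm (n := 1) (f₀' := L') hz
      (by rw [hL']; exact (hy.2.1.differentiableAt (by simp)).hasFDerivAt) hy.2.1
    exact (this.differentiableAt (by simp)).differentiableWithinAt

/-- The inverse function theorem, in charts, for maps of manifolds. -/
theorem ContMDiffOn.exists_openPartialHomeomorph {E F H G X Z : Type*} [NormedAddCommGroup E]
    [NormedSpace ℝ E] [CompleteSpace E] [NormedAddCommGroup F] [NormedSpace ℝ F]
    [TopologicalSpace H] [TopologicalSpace G] {I : ModelWithCorners ℝ E H} [I.Boundaryless]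
    {J : ModelWithCorners ℝ F G} [TopologicalSpace X] [ChartedSpace H X]
    [IsManifold I 1 X] [TopologicalSpace Z] [ChartedSpace G Z] [IsManifold J 1 Z]
    {f : X → Z} {U : Set X} (hU : IsOpen U) (hf : ContMDiffOn I J 1 f U) {p : X} (hp : p ∈ U)
    (hinv : (mfderiv I J f p).IsInvertible) :
    ∃ φ : OpenPartialHomeomorph E F, extChartAt I p p ∈ φ.source ∧
      φ.source ⊆ (extChartAt I p).target ∧
      (∀ y ∈ φ.source, (extChartAt I p).symm y ∈ U ∧
        f ((extChartAt I p).symm y) ∈ (extChartAt J (f p)).source ∧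
        φ y = extChartAt J (f p) (f ((extChartAt I p).symm y)) ∧
        (mfderiv I J f ((extChartAt I p).symm y)).IsInvertible) ∧
      DifferentiableOn ℝ φ φ.source ∧ DifferentiableOn ℝ φ.symm φ.target := by
  set e := extChartAt I p with he
  set e' := extChartAt J (f p) with he'
  set O := e.target ∩ e.symm ⁻¹' (U ∩ f ⁻¹' e'.source) with hO
  have hOo : IsOpen O :=
    (continuousOn_extChartAt_symm p).isOpen_inter_preimage (isOpen_extChartAt_target p)
      (hf.continuousOn.isOpen_inter_preimage hU (isOpen_extChartAt_source (f p)))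
  have hpO : e p ∈ O := by
    refine ⟨mem_extChartAt_target p, ?_⟩
    rw [mem_preimage, extChartAt_to_inv]
    exact ⟨hp, mem_extChartAt_source (f p)⟩
  set g := e' ∘ f ∘ e.symm with hg
  have h1 : ∀ y ∈ O, ContMDiffAt 𝓘(ℝ, E) I 1 e.symm y := fun y hy =>
    (contMDiffOn_extChartAt_symm p).contMDiffAt ((isOpen_extChartAt_target p).mem_nhds hy.1)
  have h2 : ∀ y ∈ O, ContMDiffAt I J 1 f (e.symm y) := fun y hy =>
    hf.contMDiffAt (hU.mem_nhds hy.2.1)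
  have h3 : ∀ y ∈ O, ContMDiffAt J 𝓘(ℝ, F) 1 e' (f (e.symm y)) := fun y hy =>
    contMDiffAt_extChartAt' (by rw [← extChartAt_source J]; exact hy.2.2)
  have hgc : ∀ y ∈ O, ContDiffAt ℝ 1 g y := fun y hy =>
    contMDiffAt_iff_contDiffAt.1 ((h3 y hy).comp y ((h2 y hy).comp y (h1 y hy)))
  -- By the chain rule the two derivatives differ by the invertible derivatives of the charts.
  have hgi : ∀ y ∈ O, (fderiv ℝ g y).IsInvertible ↔ (mfderiv I J f (e.symm y)).IsInvertible := by
    intro y hy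
    have hd : fderiv ℝ g y = (mfderiv J 𝓘(ℝ, F) e' (f (e.symm y))).comp
        ((mfderiv I J f (e.symm y)).comp (mfderiv 𝓘(ℝ, E) I e.symm y)) := by
      rw [← mfderiv_eq_fderiv, hg, mfderiv_comp y (I' := J), mfderiv_comp y (I' := I)]
      · rfl
      · exact (h2 y hy).mdifferentiableAt (by simp)
      · exact (h1 y hy).mdifferentiableAt (by simp)
      · exact (h3 y hy).mdifferentiableAt (by simp)
      · exact ((h2 y hy).comp y (h1 y hy)).mdifferentiableAt (by simp)
    obtain ⟨L', hL'⟩ := isInvertible_mfderiv_extChartAt (I := J) (x := f p) hy.2.2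
    obtain ⟨L, hL⟩ : (mfderiv 𝓘(ℝ, E) I e.symm y).IsInvertible := by
      have := isInvertible_mfderivWithin_extChartAt_symm (I := I) hy.1
      rwa [I.range_eq_univ, mfderivWithin_univ] at this
    rw [hd, ← hL', ← hL]
    exact ContinuousLinearMap.isInvertible_equiv_comp.trans
      ContinuousLinearMap.isInvertible_comp_equiv
  have hpinv : (fderiv ℝ g (e p)).IsInvertible := by
    rw [hgi _ hpO]
    convert! hinv <;> exact extChartAt_to_inv p
  obtain ⟨φ, hφg, hφp, hφO, hφi, hφd, hφd'⟩ :=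
    (hgc _ hpO).exists_openPartialHomeomorph hpinv (hOo.mem_nhds hpO)
  refine ⟨φ, hφp, fun y hy => (hφO hy).1, fun y hy => ⟨(hφO hy).2.1, (hφO hy).2.2, ?_, ?_⟩,
    hφd, hφd'⟩
  · rw [hφg]; rfl
  · exact (hgi y (hφO hy)).1 (hφi y hy)

/-! ### Regular points of maps `M × ℝ → Z` -/

section

variable {d : ℕ} {Z M : Type*}
  [TopologicalSpace Z] [ChartedSpace (EuclideanSpace ℝ (Fin (d + 1))) Z]
  [IsManifold (𝓡 (d + 1)) 1 Z] [MeasurableSpace Z] [BorelSpace Z]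
  [TopologicalSpace M] [SecondCountableTopology M]
  [ChartedSpace (EuclideanSpace ℝ (Fin d)) M] [IsManifold (𝓡 d) 1 M]
  [MeasurableSpace M] [BorelSpace M]

/-- Around a regular point, a `C^1` map `M × ℝ → Z` is injective and preserves Borel sets and their
null sets in both directions. -/
theorem ContMDiffOn.exists_isOpen_injOn {μZ : Measure Z} (hμZ : IsLebesgueClass (d + 1) μZ)
    {μM : Measure M} [SFinite μM] (hμM : IsLebesgueClass d μM) {f : M × ℝ → Z} {U : Set (M × ℝ)}
    (hU : IsOpen U) (hf : ContMDiffOn ((𝓡 d).prod 𝓘(ℝ, ℝ)) (𝓡 (d + 1)) 1 f U) {p : M × ℝ}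
    (hp : p ∈ U) (hinv : (mfderiv ((𝓡 d).prod 𝓘(ℝ, ℝ)) (𝓡 (d + 1)) f p).IsInvertible) :
    ∃ V : Set (M × ℝ), IsOpen V ∧ p ∈ V ∧
      (∀ x ∈ V, x ∈ U ∧ (mfderiv ((𝓡 d).prod 𝓘(ℝ, ℝ)) (𝓡 (d + 1)) f x).IsInvertible) ∧
      InjOn f V ∧ (∀ B ⊆ V, MeasurableSet B → MeasurableSet (f '' B)) ∧
      ∀ B ⊆ V, MeasurableSet B → (μZ (f '' B) = 0 ↔ μM.prod volume B = 0) := by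
  obtain ⟨φ, hφp, -, hφ, hφd, hφd'⟩ := hf.exists_openPartialHomeomorph hU hp hinv
  set a := chartAt (EuclideanSpace ℝ (Fin d)) p.1 with ha
  set e := a.prod (OpenPartialHomeomorph.refl ℝ) with he
  set e' := chartAt (EuclideanSpace ℝ (Fin (d + 1))) (f p) with he'
  have hes : ∀ x ∈ e.source,
      (extChartAt ((𝓡 d).prod 𝓘(ℝ, ℝ)) p).symm (e x) = x := fun x hx => e.left_inv hx
  set V := e.source ∩ e ⁻¹' φ.source with hV
  have hVφ : ∀ x ∈ V, x ∈ U ∧ f x ∈ e'.source ∧ φ (e x) = e' (f x) ∧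
      (mfderiv ((𝓡 d).prod 𝓘(ℝ, ℝ)) (𝓡 (d + 1)) f x).IsInvertible := by
    intro x hx
    obtain ⟨h1, h2, h3, h4⟩ := hφ (e x) hx.2
    rw [hes x hx.1] at h1 h2 h3 h4
    refine ⟨h1, ?_, h3, h4⟩
    rwa [extChartAt_source] at h2
  -- Reading `φ` back through the charts gives a partial homeomorphism that agrees with `f` on `V`;
  -- injectivity and Borel images come from it.
  set ψ := e.trans (φ.trans e'.symm) with hψ
  have hψV : V ⊆ ψ.source := by
    intro x hx
    simp only [hψ, OpenPartialHomeomorph.trans_source, mem_inter_iff, mem_preimage]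
    refine ⟨hx.1, hx.2, ?_⟩
    rw [(hVφ x hx).2.2.1]
    exact e'.map_source (hVφ x hx).2.1
  have hfψ : EqOn f ψ V := by
    intro x hx
    have h := hVφ x hx
    simp only [hψ, OpenPartialHomeomorph.trans_apply]
    rw [h.2.2.1, e'.left_inv h.2.1]
  refine ⟨V, e.isOpen_inter_preimage φ.open_source, ⟨⟨mem_chart_source _ p.1, mem_univ _⟩, hφp⟩,
    fun x hx => ⟨(hVφ x hx).1, (hVφ x hx).2.2.2⟩, (ψ.injOn.mono hψV).congr hfψ.symm, ?_, ?_⟩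
  · intro B hBV hB
    rw [(hfψ.mono hBV).image_eq]
    exact ψ.measurableSet_image hB (hBV.trans hψV)
  · intro B hBV hB
    have hBe' : f '' B ⊆ e'.source := by
      rintro _ ⟨x, hx, rfl⟩
      exact (hVφ x (hBV hx)).2.1
    have himg : e' '' (f '' B) = φ '' (e '' B) := by
      rw [image_image, image_image]
      exact image_congr fun x hx => (hVφ x (hBV hx)).2.2.1.symm
    have hCφ : e '' B ⊆ φ.source := by
      rintro _ ⟨x, hx, rfl⟩
      exact (hBV hx).2
    have L : (EuclideanSpace ℝ (Fin d) × ℝ) ≃L[ℝ] EuclideanSpace ℝ (Fin (d + 1)) :=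
      ContinuousLinearEquiv.ofFinrankEq (by simp)
    have hHaar : ((volume : Measure (EuclideanSpace ℝ (Fin d))).prod
      (volume : Measure ℝ)).IsAddHaarMeasure := Measure.prod.instIsAddHaarMeasure _ _
    rw [hμZ, isLebesgueNull_iff_of_mem_atlas (chart_mem_atlas _ (f p)) hBe',
      hμM.prod_null_iff (chart_mem_atlas _ p.1) hB fun x hx => (hBV hx).1.1]
    change volume (e' '' (f '' B)) = 0 ↔ (volume : Measure (EuclideanSpace ℝ (Fin d))).prod
      (volume : Measure ℝ) (e '' B) = 0
    rw [himg]
    constructor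
    · intro h
      have h2 := addHaar_image_eq_zero_of_differentiableOn volume
        ((volume : Measure (EuclideanSpace ℝ (Fin d))).prod (volume : Measure ℝ)) L.symm
        (hφd'.mono (s := φ '' (e '' B)) (by
          rintro _ ⟨y, hy, rfl⟩
          exact φ.map_source (hCφ hy))) h
      rwa [image_image, image_congr fun y hy => φ.left_inv (hCφ hy), image_id'] at h2
    · exact addHaar_image_eq_zero_of_differentiableOn _ _ L (hφd.mono hCφ)

/-- The density of the pullback of a measure of Lebesgue class under a `C^1` map `M × ℝ → Z`
restricted to the regular points in a Borel set. -/
theorem ContMDiffOn.exists_density {μZ : Measure Z} [IsFiniteMeasure μZ]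
    (hμZ : IsLebesgueClass (d + 1) μZ) {μM : Measure M} [SigmaFinite μM]
    (hμM : IsLebesgueClass d μM) {f : M × ℝ → Z} {U : Set (M × ℝ)}
    (hU : IsOpen U) (hf : ContMDiffOn ((𝓡 d).prod 𝓘(ℝ, ℝ)) (𝓡 (d + 1)) 1 f U)
    {T : Set (M × ℝ)} (hT : MeasurableSet T) :
    ∃ r : M × ℝ → ℝ≥0, Measurable r ∧ (∀ p, 0 < r p ↔ p ∈ T ∧ p ∈ U ∧
        (mfderiv ((𝓡 d).prod 𝓘(ℝ, ℝ)) (𝓡 (d + 1)) f p).IsInvertible) ∧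
      ∀ h : M × ℝ → ℝ≥0∞, Measurable h →
        Measurable (fun z => ∑' p : {p // 0 < r p ∧ f p = z}, h p) ∧
        ∫⁻ z, ∑' p : {p // 0 < r p ∧ f p = z}, h p ∂μZ = ∫⁻ p, h p * r p ∂(μM.prod volume) := by
  set R := {p | p ∈ U ∧ (mfderiv ((𝓡 d).prod 𝓘(ℝ, ℝ)) (𝓡 (d + 1)) f p).IsInvertible} with hR
  choose! V hVo hpV hVR hVinj hVimg hVnull using fun p (hp : p ∈ R) =>
    hf.exists_isOpen_injOn hμZ hμM hU hp.1 hp.2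
  -- Countably many neighborhoods suffice since `M × ℝ` is second countable. The empty set is added
  -- so that `ℕ` enumerates the cover even when `R` is empty.
  obtain ⟨t, htR, htc, htV⟩ := TopologicalSpace.countable_cover_nhdsWithin
    (f := V) (s := R) fun p hp => mem_nhdsWithin_of_mem_nhds ((hVo p hp).mem_nhds (hpV p hp))
  obtain ⟨W, hW⟩ : ∃ W : ℕ → Set (M × ℝ), insert ∅ (V '' t) = range W :=
    ((htc.image V).insert ∅).exists_eq_range (insert_nonempty _ _)
  have hWcase : ∀ i, W i = ∅ ∨ ∃ p ∈ R, W i = V p := by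
    intro i
    rcases (hW ▸ mem_range_self i : W i ∈ insert ∅ (V '' t)) with h | ⟨p, hp, h⟩
    · exact Or.inl h
    · exact Or.inr ⟨p, htR hp, h.symm⟩
  have hWR : ⋃ i, W i = R := by
    refine Subset.antisymm (iUnion_subset fun i => ?_) fun x hx => ?_
    · rcases hWcase i with h | ⟨p, hp, h⟩
      · simp [h]
      · rw [h]; exact hVR p hp
    · obtain ⟨p, hp, hxp⟩ := mem_iUnion₂.1 (htV hx)
      obtain ⟨i, hi⟩ : V p ∈ range W := hW ▸ mem_insert_of_mem _ (mem_image_of_mem V hp)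
      exact mem_iUnion.2 ⟨i, hi ▸ hxp⟩
  have hWm : ∀ i, MeasurableSet (W i) := by
    intro i
    rcases hWcase i with h | ⟨p, hp, h⟩
    · simp [h]
    · rw [h]; exact (hVo p hp).measurableSet
  -- Disjoint pieces of the cover count every regular point of `T` exactly once.
  set A := fun i => T ∩ disjointed W i with hA
  have hAW : ∀ i, A i ⊆ W i := fun i => inter_subset_right.trans (disjointed_subset W i)
  have hAm : ∀ i, MeasurableSet (A i) := fun i => hT.inter (MeasurableSet.disjointed hWm i)
  have hAU : ∀ i, A i ⊆ U := fun i x hx =>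
    (hWR ▸ mem_iUnion_of_mem i (hAW i hx) : x ∈ R).1
  obtain ⟨r, hrm, hr, hrh⟩ := exists_density_of_injOn_iUnion f (μM.prod volume) μZ (A := A)
    (fun i j hij => (disjoint_disjointed W hij).mono inter_subset_right inter_subset_right)
    hAm
    (fun i => by
      rcases hWcase i with h | ⟨p, hp, h⟩
      · exact (h ▸ injOn_empty f : InjOn f (W i)).mono (hAW i)
      · exact (h ▸ hVinj p hp : InjOn f (W i)).mono (hAW i))
    (fun i C hC => by
      have := (hAm i).inter (hf.continuousOn.measurableSet_inter_preimage hU.measurableSet hC)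
      rwa [← inter_assoc, inter_eq_left.2 (hAU i)] at this)
    (fun i B hBA hB => by
      rcases hWcase i with h | ⟨p, hp, h⟩
      · have : B = ∅ := subset_empty_iff.1 (h ▸ hBA.trans (hAW i))
        simp [this]
      · exact hVimg p hp B (h ▸ hBA.trans (hAW i)) hB)
    (fun i B hBA hB => by
      rcases hWcase i with h | ⟨p, hp, h⟩
      · have : B = ∅ := subset_empty_iff.1 (h ▸ hBA.trans (hAW i))
        simp [this]
      · exact hVnull p hp B (h ▸ hBA.trans (hAW i)) hB)
  have hAR : ⋃ i, A i = T ∩ R := by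
    rw [hA, ← inter_iUnion, iUnion_disjointed, hWR]
  refine ⟨r, hrm, fun p => ?_, fun h hh => ?_⟩
  · rw [hr, hAR]; rfl
  · have hS : ⋃ i, A i = {p | 0 < r p} := Set.ext fun p => (hr p).symm
    rw [hS] at hrh
    exact hrh h hh

end

/-! ### Submersions and linear algebra -/

section

variable {E F H G X Z : Type*} [NormedAddCommGroup E]
  [NormedSpace ℝ E] [NormedAddCommGroup F] [NormedSpace ℝ F]
  [TopologicalSpace H] [TopologicalSpace G] {I : ModelWithCorners ℝ E H}
  {J : ModelWithCorners ℝ F G} [TopologicalSpace X] [ChartedSpace H X]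
  [TopologicalSpace Z] [ChartedSpace G Z]

/-- In adapted charts `q` is a projection; freezing the complementary coordinate at its value at `x`
gives a local section `σ` through `x`, whose differential is a right inverse of that of `q`. -/
theorem Manifold.IsSubmersionAt.mfderiv_surjective [I.Boundaryless] [J.Boundaryless]
    [IsManifold I 1 X] [IsManifold J 1 Z] {q : X → Z} {x : X} (hq : IsSubmersionAt I J 1 q x) :
    Function.Surjective (mfderiv I J q x) := by
  set a := hq.domChart.extend I with ha
  set c := hq.codChart.extend J with hc
  have hxa : x ∈ a.source := by rw [ha, OpenPartialHomeomorph.extend_source]; exact hq.mem_domChart_source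
  have hxc : q x ∈ c.source := by rw [hc, OpenPartialHomeomorph.extend_source]; exact hq.mem_codChart_source
  set σ : Z → X := fun z => a.symm (hq.equiv.symm (c z, (hq.equiv (a x)).2)) with hσ
  have hcx : c (q x) = (hq.equiv (a x)).1 := by
    have := hq.writtenInCharts (a.map_source hxa)
    simp only [Function.comp_apply] at this
    rw [← ha, a.left_inv hxa] at this
    exact this
  have h0 : hq.equiv.symm (c (q x), (hq.equiv (a x)).2) = a x := by
    rw [hcx]; simp
  have hσx : σ (q x) = x := by
    rw [hσ]; simp only; rw [h0, a.left_inv hxa]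
  have hct : MDifferentiableAt J 𝓘(ℝ, F) c (q x) :=
    (hq.codChart.contMDiffAt_extend (n := 1) hq.codChart_mem_maximalAtlas
      hq.mem_codChart_source).mdifferentiableAt (by simp)
  have hatn : a.target ∈ nhds (a x) := by
    exact hq.domChart.isOpen_extend_target.mem_nhds (a.map_source hxa)
  have has : MDifferentiableAt 𝓘(ℝ, E) I a.symm (a x) := by
    have h := contMDiffOn_extend_symm (n := 1) hq.domChart_mem_maximalAtlas
    rw [← OpenPartialHomeomorph.extend_target'] at h
    exact (h.contMDiffAt hatn).mdifferentiableAt (by simp)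
  have hlin : DifferentiableAt ℝ
      (fun v => hq.equiv.symm (v, (hq.equiv (a x)).2)) (c (q x)) := by fun_prop
  have hcomp : MDifferentiableAt J 𝓘(ℝ, E)
      (fun z => hq.equiv.symm (c z, (hq.equiv (a x)).2)) (q x) :=
    hlin.mdifferentiableAt.comp (q x) hct
  have hσd : MDifferentiableAt J I σ (q x) := by
    refine MDifferentiableAt.comp (I' := 𝓘(ℝ, E)) (q x) (g := a.symm) ?_ hcomp
    rw [h0]; exact has
  have hqσ : q ∘ σ =ᶠ[nhds (q x)] id := by
    have h1 : ∀ᶠ z in nhds (q x), hq.equiv.symm (c z, (hq.equiv (a x)).2) ∈ a.target :=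
      hcomp.continuousAt (by rw [h0]; exact hatn)
    have h2 : ∀ᶠ z in nhds (q x), z ∈ c.source := by
      rw [hc]; exact hq.codChart.extend_source_mem_nhds hq.mem_codChart_source
    filter_upwards [h1, h2] with z hz1 hz2
    have h3 := hq.writtenInCharts hz1
    simp only [Function.comp_apply, ContinuousLinearEquiv.apply_symm_apply] at h3
    have h4 : q (σ z) ∈ c.source := by
      rw [hc, OpenPartialHomeomorph.extend_source]
      apply hq.source_subset_preimage_source
      rw [← OpenPartialHomeomorph.extend_source (I := I)]
      exact a.map_target hz1
    exact c.injOn h4 hz2 h3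
  have hqd : MDifferentiableAt I J q (σ (q x)) := by
    rw [hσx]; exact hq.contMDiffAt.mdifferentiableAt (by simp)
  have hd : (mfderiv I J q (σ (q x))).comp (mfderiv J I σ (q x)) =
      ContinuousLinearMap.id ℝ (TangentSpace J (q x)) := by
    rw [← mfderiv_comp (q x) hqd hσd, hqσ.mfderiv_eq, mfderiv_id]
  rw [hσx] at hd
  intro v
  exact ⟨mfderiv J I σ (q x) v, DFunLike.congr_fun hd v⟩

end

theorem ContinuousLinearMap.isInvertible_iff_surjective {E F : Type*} [NormedAddCommGroup E]
    [NormedSpace ℝ E] [FiniteDimensional ℝ E] [NormedAddCommGroup F] [NormedSpace ℝ F]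
    [FiniteDimensional ℝ F] (h : Module.finrank ℝ E = Module.finrank ℝ F) (L : E →L[ℝ] F) :
    L.IsInvertible ↔ Function.Surjective L := by
  refine ⟨fun h => h.surjective, fun hs => ?_⟩
  have hi : Function.Injective L :=
    (LinearMap.injective_iff_surjective_of_finrank_eq_finrank h (f := L.toLinearMap)).2 hs
  exact ⟨(LinearEquiv.ofBijective L.toLinearMap ⟨hi, hs⟩).toContinuousLinearEquiv, by ext; rfl⟩

/-! ### Geometry of the flow: the sweep map, transversality and visits -/

namespace PiecewiseFlow

variable {n d : ℕ} {Ψ Z M : Type*}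
  [TopologicalSpace Ψ] [ChartedSpace (EuclideanSpace ℝ (Fin n)) Ψ]
  [TopologicalSpace Z] [ChartedSpace (EuclideanSpace ℝ (Fin (d + 1))) Z]
  [TopologicalSpace M] [ChartedSpace (EuclideanSpace ℝ (Fin d)) M]
  (Φ : PiecewiseFlow n Ψ) {q : Ψ → Z} {ι : M → Ψ}

theorem zero_mem {t : ℝ} {x : Ψ} (h : (t, x) ∈ Φ.dom) : (0, x) ∈ Φ.dom := by
  simpa using Φ.add_mem h (Φ.neg_mem h)

theorem map_neg_map {t : ℝ} {x : Ψ} (h : (t, x) ∈ Φ.dom) : Φ.map (-t) (Φ.map t x) = x := by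
  rw [← Φ.map_add h (Φ.neg_mem h), neg_add_cancel, Φ.map_zero]

theorem map_map_neg {t : ℝ} {x : Ψ} (h : (-t, x) ∈ Φ.dom) : Φ.map t (Φ.map (-t) x) = x := by
  simpa using Φ.map_neg_map h

theorem zero_mem_map {t : ℝ} {x : Ψ} (h : (t, x) ∈ Φ.dom) : (0, Φ.map t x) ∈ Φ.dom :=
  Φ.zero_mem (Φ.neg_mem h)

theorem isOpen_setOf_neg_mem_dom (hι : Continuous ι) :
    IsOpen {p : M × ℝ | (-p.2, ι p.1) ∈ Φ.dom} :=
  Φ.isOpen_dom.preimage (by fun_prop : Continuous fun p : M × ℝ => (-p.2, ι p.1))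

theorem contMDiffOn_sweep (hι : ContMDiff (𝓡 d) (𝓡 n) 1 ι) :
    ContMDiffOn ((𝓡 d).prod 𝓘(ℝ, ℝ)) (𝓡 n) 1 (fun p : M × ℝ => Φ.map (-p.2) (ι p.1))
      {p | (-p.2, ι p.1) ∈ Φ.dom} := by
  have h1 : ContMDiff ((𝓡 d).prod 𝓘(ℝ, ℝ)) 𝓘(ℝ, ℝ) 1 (fun p : M × ℝ => -p.2) :=
    contDiff_neg.contMDiff.comp contMDiff_snd
  have h2 : ContMDiff ((𝓡 d).prod 𝓘(ℝ, ℝ)) (𝓡 n) 1 (fun p : M × ℝ => ι p.1) :=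
    hι.comp contMDiff_fst
  exact Φ.contMDiffOn.comp (h1.prodMk h2).contMDiffOn fun p hp => hp

theorem mdifferentiableAt_map {t : ℝ} {x : Ψ} (h : (t, x) ∈ Φ.dom) :
    MDifferentiableAt 𝓘(ℝ, ℝ) (𝓡 n) (fun s => Φ.map s x) t := by
  have h1 : MDifferentiableAt (𝓘(ℝ, ℝ).prod (𝓡 n)) (𝓡 n) (fun p : ℝ × Ψ => Φ.map p.1 p.2) (t, x) :=
    (Φ.contMDiffOn.contMDiffAt (Φ.isOpen_dom.mem_nhds h)).mdifferentiableAt (by simp)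
  exact MDifferentiableAt.comp (I' := 𝓘(ℝ, ℝ).prod (𝓡 n)) t (f := fun s => (s, x)) h1
    (mdifferentiableAt_id.prodMk mdifferentiableAt_const)

/-- The backward orbit of `x` has velocity `-V` at each of its points. -/
theorem mfderiv_map_neg {t : ℝ} {x : Ψ} (h : (-t, x) ∈ Φ.dom) (s : ℝ) :
    mfderiv 𝓘(ℝ, ℝ) (𝓡 n) (fun τ => Φ.map (-τ) x) t s = -s • Φ.velocity (Φ.map (-t) x) := by
  have h0 := Φ.zero_mem_map h
  -- The group law `b^{-τ} x = b^{t-τ} (b^{-t} x)` moves the derivative at time `t` to time `0`,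
  -- with a minus sign.
  have hev : (fun τ => Φ.map (-τ) x) =ᶠ[nhds t]
      (fun τ => Φ.map τ (Φ.map (-t) x)) ∘ fun τ => t - τ := by
    have hc : ContinuousAt (fun τ : ℝ => (t - τ, Φ.map (-t) x)) t := by fun_prop
    have : ∀ᶠ τ in nhds t, (t - τ, Φ.map (-t) x) ∈ Φ.dom :=
      hc (Φ.isOpen_dom.mem_nhds (by simpa using h0))
    filter_upwards [this] with τ hτ
    rw [Function.comp_apply, ← Φ.map_add h hτ]
    congr 1
    ring
  have hsub : HasMFDerivAt 𝓘(ℝ, ℝ) 𝓘(ℝ, ℝ) (fun τ : ℝ => t - τ) t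
      (-ContinuousLinearMap.id ℝ ℝ) :=
    ((hasFDerivAt_id t).const_sub t).hasMFDerivAt
  have hV : HasMFDerivAt 𝓘(ℝ, ℝ) (𝓡 n) (fun τ => Φ.map τ (Φ.map (-t) x)) (t - t)
      (mfderiv 𝓘(ℝ, ℝ) (𝓡 n) (fun τ => Φ.map τ (Φ.map (-t) x)) 0) := by
    rw [sub_self]
    exact (Φ.mdifferentiableAt_map h0).hasMFDerivAt
  have hd := (HasMFDerivAt.comp t hV hsub).congr_of_eventuallyEq hev
  rw [hd.mfderiv]
  change mfderiv 𝓘(ℝ, ℝ) (𝓡 n) (fun τ => Φ.map τ (Φ.map (-t) x)) 0 (-s) = _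
  refine (congrArg _ (by simp : (-s : ℝ) = -s • (1 : ℝ))).trans ?_
  exact (mfderiv 𝓘(ℝ, ℝ) (𝓡 n) (fun τ => Φ.map τ (Φ.map (-t) x)) 0).map_smul (-s) (1 : ℝ)

/-- The differential is the sum of its two partial differentials, along `M` and along time; the
latter is `-V`, which spans the same line as `V`. -/
theorem range_mfderiv_sweep [IsManifold (𝓡 n) 1 Ψ] [IsManifold (𝓡 d) 1 M]
    (hι : ContMDiff (𝓡 d) (𝓡 n) 1 ι) {p : M × ℝ} (hp : (-p.2, ι p.1) ∈ Φ.dom) :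
    LinearMap.range (mfderiv ((𝓡 d).prod 𝓘(ℝ, ℝ)) (𝓡 n)
      (fun p : M × ℝ => Φ.map (-p.2) (ι p.1)) p).toLinearMap = Φ.sweepTangent d ι (-p.2) p.1 := by
  have hd : MDifferentiableAt ((𝓡 d).prod 𝓘(ℝ, ℝ)) (𝓡 n)
      (fun p : M × ℝ => Φ.map (-p.2) (ι p.1)) p :=
    ((Φ.contMDiffOn_sweep hι).contMDiffAt
      ((Φ.isOpen_setOf_neg_mem_dom hι.continuous).mem_nhds hp)).mdifferentiableAt (by simp)
  have happ : ∀ v : EuclideanSpace ℝ (Fin d) × ℝ, mfderiv ((𝓡 d).prod 𝓘(ℝ, ℝ)) (𝓡 n)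
      (fun p : M × ℝ => Φ.map (-p.2) (ι p.1)) p v =
      mfderiv (𝓡 d) (𝓡 n) (fun m' : M => Φ.map (-p.2) (ι m')) p.1 v.1 +
        (-v.2) • Φ.velocity (Φ.map (-p.2) (ι p.1)) := by
    intro v
    rw [← Φ.mfderiv_map_neg hp v.2]
    exact mfderiv_prod_eq_add_apply hd
  ext y
  rw [sweepTangent, Submodule.mem_sup]
  constructor
  · rintro ⟨v, rfl⟩
    exact ⟨_, ⟨v.1, rfl⟩, _, Submodule.mem_span_singleton.2 ⟨-v.2, rfl⟩, (happ v).symm⟩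
  · rintro ⟨_, ⟨v, rfl⟩, _, hz, rfl⟩
    obtain ⟨c, rfl⟩ := Submodule.mem_span_singleton.1 hz
    refine ⟨((v, -c) : EuclideanSpace ℝ (Fin d) × ℝ), ?_⟩
    refine (happ _).trans ?_
    simp only [neg_neg]
    rfl

/-- The map `(m, t) ↦ q (b^{-t} m)` is regular at the points of transversality. -/
theorem isInvertible_mfderiv_iff [IsManifold (𝓡 n) 1 Ψ] [IsManifold (𝓡 (d + 1)) 1 Z]
    [IsManifold (𝓡 d) 1 M] (hq : IsSubmersion (𝓡 n) (𝓡 (d + 1)) 1 q)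
    (hι : ContMDiff (𝓡 d) (𝓡 n) 1 ι) {p : M × ℝ} (hp : (-p.2, ι p.1) ∈ Φ.dom) :
    (mfderiv ((𝓡 d).prod 𝓘(ℝ, ℝ)) (𝓡 (d + 1))
      (fun p : M × ℝ => q (Φ.map (-p.2) (ι p.1))) p).IsInvertible ↔
      Φ.SweepTransversalAt d q ι (-p.2) p.1 := by
  set b : M × ℝ → Ψ := fun p => Φ.map (-p.2) (ι p.1) with hb
  have hd : MDifferentiableAt ((𝓡 d).prod 𝓘(ℝ, ℝ)) (𝓡 n) b p :=
    ((Φ.contMDiffOn_sweep hι).contMDiffAt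
      ((Φ.isOpen_setOf_neg_mem_dom hι.continuous).mem_nhds hp)).mdifferentiableAt (by simp)
  have hqd : MDifferentiableAt (𝓡 n) (𝓡 (d + 1)) q (b p) :=
    hq.contMDiff.contMDiffAt.mdifferentiableAt (by simp)
  have hqs := (hq.isSubmersionAt (b p)).mfderiv_surjective
  have hc : mfderiv ((𝓡 d).prod 𝓘(ℝ, ℝ)) (𝓡 (d + 1)) (q ∘ b) p =
      (mfderiv (𝓡 n) (𝓡 (d + 1)) q (b p)).comp (mfderiv ((𝓡 d).prod 𝓘(ℝ, ℝ)) (𝓡 n) b p) :=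
    mfderiv_comp p hqd hd
  have hfin : Module.finrank ℝ (EuclideanSpace ℝ (Fin d) × ℝ) =
      Module.finrank ℝ (EuclideanSpace ℝ (Fin (d + 1))) := by simp
  rw [SweepTransversalAt, ← Φ.range_mfderiv_sweep hι hp]
  refine (ContinuousLinearMap.isInvertible_iff_surjective hfin _).trans ?_
  change Function.Surjective (mfderiv ((𝓡 d).prod 𝓘(ℝ, ℝ)) (𝓡 (d + 1)) (q ∘ b) p) ↔ _
  rw [hc]
  -- Since `dq` is onto, `dq` maps the range of `db` onto everything exactly when that range and
  -- `ker dq` together span.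
  refine Iff.trans ?_ (LinearMap.map_eq_top_iff (LinearMap.range_eq_top.2 hqs))
  rw [← LinearMap.range_comp]
  exact LinearMap.range_eq_top.symm

/-- The visits to `M` of the orbits that start in the fiber over `z` are the pairs `(b^{-t} m, t)`
with `q (b^{-t} m) = z`. -/
noncomputable def visitsEquiv (q : Ψ → Z) (hι : Function.Injective ι) (z : Z) :
    {p : M × ℝ // p ∈ Φ.backwardDomain ι ∧ q (Φ.map (-p.2) (ι p.1)) = z} ≃ Φ.visits q ι z :=
  Equiv.ofBijective
    (fun p => ⟨(Φ.map (-p.1.2) (ι p.1.1), p.1.2), p.2.2, p.2.1.1,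
      by simpa using Φ.neg_mem p.2.1.2, by
        rw [Φ.map_map_neg p.2.1.2]; exact mem_range_self _⟩) <| by
    constructor
    · rintro ⟨⟨m, t⟩, ⟨_, h1⟩, _⟩ ⟨⟨m', t'⟩, ⟨_, h2⟩, _⟩ h
      obtain ⟨hx, rfl⟩ := Prod.mk.inj (congrArg Subtype.val h)
      simp only [Subtype.mk.injEq, Prod.mk.injEq] at h1 h2 hx ⊢
      refine ⟨hι ?_, trivial⟩
      rw [← Φ.map_map_neg h1, hx, Φ.map_map_neg h2]
    · rintro ⟨⟨x, t⟩, hq, ht, hx, m, hm⟩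
      simp only at hq ht hx hm
      have hmx : Φ.map (-t) (ι m) = x := by rw [hm, Φ.map_neg_map hx]
      refine ⟨⟨(m, t), ⟨ht, ?_⟩, ?_⟩, ?_⟩
      · simp only [hm]; exact Φ.neg_mem hx
      · simp only [hmx, hq]
      · simp only [hmx]

end PiecewiseFlow

/-! ### The proposition -/

theorem mainTheorem8 {n d : ℕ} {Ψ Z M : Type*}
    [TopologicalSpace Ψ] [T2Space Ψ] [SecondCountableTopology Ψ]
    [ChartedSpace (EuclideanSpace ℝ (Fin n)) Ψ] [IsManifold (𝓡 n) 1 Ψ]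
    [MeasurableSpace Ψ] [BorelSpace Ψ]
    [TopologicalSpace Z] [T2Space Z] [SecondCountableTopology Z]
    [ChartedSpace (EuclideanSpace ℝ (Fin (d + 1))) Z] [IsManifold (𝓡 (d + 1)) 1 Z]
    [MeasurableSpace Z] [BorelSpace Z]
    [TopologicalSpace M] [T2Space M] [SecondCountableTopology M]
    [ChartedSpace (EuclideanSpace ℝ (Fin d)) M] [IsManifold (𝓡 d) 1 M]
    [MeasurableSpace M] [BorelSpace M]
    -- the flow, the fibration with fibers transversal to it, and the submanifold
    (Φ : PiecewiseFlow n Ψ)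
    (q : Ψ → Z) (hq : IsSubmersion (𝓡 n) (𝓡 (d + 1)) 1 q) (hq_surj : Function.Surjective q)
    (hqΦ : Φ.FibersTransversal d q)
    (ι : M → Ψ) (hι : IsSmoothEmbedding (𝓡 d) (𝓡 n) 1 ι)
    (hιΦ : Φ.SubmanifoldTransversal d ι)
    -- the finite measures of Lebesgue class on the base and on the submanifold
    (μZ : Measure Z) [IsFiniteMeasure μZ] (hμZ : IsLebesgueClass (d + 1) μZ)
    (μM : Measure M) [IsFiniteMeasure μM] (hμM : IsLebesgueClass d μM)
    -- the swept-out set is transversal to (almost) all fibers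
    (hN : ∀ᵐ z ∂μZ, Φ.SweepTransversalToFiber d q ι z) :
    ∃ r : M × ℝ → ℝ≥0, Measurable r ∧
      -- positivity
      (∀ p : M × ℝ, 0 < r p ↔ p ∈ Φ.backwardDomain ι ∧ Φ.SweepTransversalAt d q ι (-p.2) p.1) ∧
      -- `r dm dt` is the pullback of `dz` under `f (m, t) = q (b^{-t} m)`
      (∀ A : Set (M × ℝ), MeasurableSet A → A ⊆ Φ.backwardDomain ι →
        InjOn (fun p : M × ℝ => q (Φ.map (-p.2) (ι p.1))) A →
        ∫⁻ p in A, (r p : ℝ≥0∞) ∂(μM.prod volume) =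
          μZ ((fun p : M × ℝ => q (Φ.map (-p.2) (ι p.1))) '' A)) ∧
      -- the averaged counting function, for every weight
      ∀ w : Ψ × ℝ → ℝ≥0∞, Measurable w →
        AEMeasurable (Φ.countingFunction q ι w) μZ ∧
        ∫⁻ z, Φ.countingFunction q ι w z ∂μZ =
          ∫⁻ p in univ ×ˢ Ici (0 : ℝ),
            w (Φ.map (-p.2) (ι p.1), p.2) * (r p : ℝ≥0∞) ∂(μM.prod volume) := by

  classical
  have hιc := hι.contMDiff
  have hb := Φ.contMDiffOn_sweep hιc
  have hUo := Φ.isOpen_setOf_neg_mem_dom hιc.continuous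
  set U : Set (M × ℝ) := {p | (-p.2, ι p.1) ∈ Φ.dom} with hU
  set f : M × ℝ → Z := fun p => q (Φ.map (-p.2) (ι p.1)) with hf
  have hT : MeasurableSet {p : M × ℝ | 0 ≤ p.2} := measurableSet_le measurable_const measurable_snd
  have hfc : ContMDiffOn ((𝓡 d).prod 𝓘(ℝ, ℝ)) (𝓡 (d + 1)) 1 f U :=
    hq.contMDiff.comp_contMDiffOn hb
  obtain ⟨r, hrm, hrpos, hr⟩ := hfc.exists_density hμZ hμM hUo hT
  have hrpos' : ∀ p : M × ℝ, 0 < r p ↔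
      p ∈ Φ.backwardDomain ι ∧ Φ.SweepTransversalAt d q ι (-p.2) p.1 := by
    intro p
    rw [hrpos]
    constructor
    · rintro ⟨h1, h2, h3⟩
      exact ⟨⟨h1, h2⟩, (Φ.isInvertible_mfderiv_iff hq hιc h2).1 h3⟩
    · rintro ⟨⟨h1, h2⟩, h3⟩
      exact ⟨h1, h2, (Φ.isInvertible_mfderiv_iff hq hιc h2).2 h3⟩
  refine ⟨r, hrm, hrpos', fun A hA hAW hAinj => ?_, fun w hw => ?_⟩
  -- With the indicator of `A` as weight, injectivity makes the fiber sum the indicator of the image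
  -- of the regular part of `A`.
  · have hsum : (fun z => ∑' p : {p // 0 < r p ∧ f p = z}, A.indicator (1 : M × ℝ → ℝ≥0∞) p) =
        (f '' (A ∩ {p | 0 < r p})).indicator 1 := by
      ext z
      by_cases hz : z ∈ f '' (A ∩ {p | 0 < r p})
      · rw [indicator_of_mem hz]
        obtain ⟨p, ⟨hpA, hp⟩, rfl⟩ := hz
        rw [tsum_eq_single ⟨p, hp, rfl⟩]
        · simp [hpA]
        · intro p' hp'
          refine indicator_of_notMem (fun h => hp' ?_) _
          exact Subtype.ext (hAinj h hpA p'.2.2)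
      · rw [indicator_of_notMem hz, ENNReal.tsum_eq_zero]
        exact fun p => indicator_of_notMem (fun h => hz ⟨p, ⟨h, p.2.1⟩, p.2.2⟩) _
    obtain ⟨h1, h2⟩ := hr (A.indicator 1) (measurable_one.indicator hA)
    rw [hsum] at h1 h2
    have himg : MeasurableSet (f '' (A ∩ {p | 0 < r p})) := by
      rwa [← measurable_indicator_const_iff (1 : ℝ≥0∞)]
    rw [lintegral_indicator_one himg] at h2
    have h3 : ∫⁻ p in A, (r p : ℝ≥0∞) ∂(μM.prod volume) =
        ∫⁻ p, A.indicator 1 p * (r p : ℝ≥0∞) ∂(μM.prod volume) := by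
      rw [← lintegral_indicator hA]
      congr 1
      ext p
      by_cases hp : p ∈ A <;> simp [hp]
    rw [h3, ← h2]
    refine le_antisymm (measure_mono (image_mono inter_subset_left)) ?_
    -- The critical points of `A` lie over the exceptional null set of `hN`, so the regular part of
    -- `A` has almost all of the image.
    refine measure_mono_ae ?_
    filter_upwards [hN] with z hz hzA
    obtain ⟨p, hp, hpz⟩ := hzA
    exact ⟨p, ⟨hp, (hrpos' p).2 ⟨hAW hp, hz p (hAW hp) hpz⟩⟩, hpz⟩
  · set b : M × ℝ → Ψ × ℝ := fun p => (Φ.map (-p.2) (ι p.1), p.2) with hbdef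
    -- Off `U` the values of `b` are meaningless and perhaps not measurable, hence the extension by
    -- zero.
    set h : M × ℝ → ℝ≥0∞ := U.indicator (w ∘ b) with hh
    have hbc : ContinuousOn b U := hb.continuousOn.prodMk continuousOn_snd
    have hhm : Measurable h := by
      refine measurable_of_restrict_of_restrict_compl hUo.measurableSet ?_ ?_
      · have : U.domRestrict h = w ∘ U.domRestrict b := by
          ext p
          simp [h, domRestrict]
        rw [this]
        exact hw.comp (continuousOn_iff_continuous_domRestrict.1 hbc).measurable
      · have : Uᶜ.domRestrict h = fun _ => 0 := by
          ext p
          exact indicator_of_notMem p.2 _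
        rw [this]
        exact measurable_const
    obtain ⟨h1, h2⟩ := hr h hhm
    have hae : Φ.countingFunction q ι w =ᵐ[μZ]
        fun z => ∑' p : {p // 0 < r p ∧ f p = z}, h p := by
      filter_upwards [hN] with z hz
      have hS : ∀ p, (0 < r p ∧ f p = z) ↔ (p ∈ Φ.backwardDomain ι ∧ f p = z) := fun p =>
        ⟨fun hp => ⟨((hrpos' p).1 hp.1).1, hp.2⟩,
          fun hp => ⟨(hrpos' p).2 ⟨hp.1, hz p hp.1 hp.2⟩, hp.2⟩⟩
      rw [PiecewiseFlow.countingFunction, ← (Φ.visitsEquiv q hι.isEmbedding.injective z).tsum_eq,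
        ← (Equiv.subtypeEquivRight hS).tsum_eq]
      refine tsum_congr fun p => ?_
      have hpU : (p : M × ℝ) ∈ U := ((hrpos p).1 p.2.1).2.1
      rw [hh, indicator_of_mem hpU]
      rfl
    refine ⟨⟨_, h1, hae⟩, ?_⟩
    rw [lintegral_congr_ae hae, h2,
      ← lintegral_indicator (MeasurableSet.univ.prod measurableSet_Ici)]
    congr 1
    ext p
    -- Both integrands vanish where `r = 0`, and `r > 0` forces `p ∈ U` and `t ≥ 0`, so neither the
    -- values off `U` nor the restriction of the domain matters.
    by_cases hp : 0 < r p
    · obtain ⟨h0, hpU, -⟩ := (hrpos p).1 hp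
      rw [hh, indicator_of_mem hpU, indicator_of_mem (show p ∈ univ ×ˢ Ici (0 : ℝ) from ⟨mem_univ _, h0⟩)]
      rfl
    · have hp0 : r p = 0 := by simpa using hp
      simp [indicator_apply, hp0]
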